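/- A probabilistic pushdown automaton (pPDA) $\Delta$ has a finite state set $Q$, a finite stack alphabet $\Gamma$, and non-negative rational weights of transitions $pZ \xrightarrow{a} q\alpha$ with $p,q\in Q$, $Z\in\Gamma$, $\alpha\in\Gamma^*$, $|\alpha|\le 2$, which sum to $1$ for every $pZ$; a transition takes the configuration $pZ\beta$ to $q\alpha\beta$ ($\beta\in\Gamma^*$), and configurations with empty stack have no successors. For $pZq\in Q\times\Gamma\times Q$ let $[pZ|q]=\sum_\pi p(\pi)$ and $E[pZ|q]=\sum_\pi p(\pi)\,|\pi|$, where $\pi$ ranges over the finite paths from $pZ$ to $q\varepsilon$, $p(\pi)$ is the product of the transition weights along $\pi$ and $|\pi|$ is the number of steps. $\Delta$ is cPAST if $E[pZ|q]/[pZ|q]<\infty$ whenever $[pZ|q]>0$. The fundamental system $f$ of $\Delta$ is the system of polynomials $$f_{pZq}=\sum_{pZ\xrightarrow{a}q\varepsilon}a+\sum_{pZ\xrightarrow{a}rY}a\,x_{rYq}+\sum_{pZ\xrightarrow{a}rYX}a\sum_{t\in Q}x_{rYt}\,x_{tXq},$$ with least fixed point $\mu f\in[0,\infty]^{Q\times\Gamma\times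 Q}$. The cleaned-up system $\hat f$ is obtained from $f$ by removing every variable $x_j$ with $(\mu f)_j=0$ (its equation is dropped and $x_j$ is replaced by $0$ elsewhere). Let $\hat f'(u)$ be the Jacobi matrix of $\hat f$ at $u$, and $\rho$ the spectral radius. Lemma (bound on spectrum). Let $\Delta$ be a cPAST pPDA with at least one positive return probability $[pZ|q]$, and let $\hat f$ be its cleaned-up fundamental system. Let $C=\max\{E[pZ|q]/[pZ|q] : [pZ|q]>0\}$ be the maximal conditional expected runtime and $m=\min\{[pZ|q] : [pZ|q]>0\}$ the minimal non-zero return probability (the smallest entry of $\mu\hat f$). Then $1\le C<\infty$, all entries of $\mu\hat f$ are finite, and there is a vector $v$ with all $v_i>0$ and $\|v\|_1=1$ such that $\hat f'(\mu\hat f)\,v\le(1-C^{-1})\,v$ entrywise and $\min_i v_i\ge \dfrac{m}{C\,|Q|^2\,|\Gamma|}$. Moreover $\rho(\hat f'(\mu\hat f))\le 1-C^{-1}$. The last bound is tight: for every rational $a$ with $\tfrac12<a\le 1$, the pPDA with a single state $p$, a single stack symbol $Z$ and the transitions $pZ\xrightarrow{a}p\varepsilon$ and $pZ\xrightarrow{1-a}pZZ$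 is cPAST with $C=\frac1{2a-1}$ and $\rho(\hat f'(\mu\hat f))=2(1-a)=1-C^{-1}$. -/

import Mathlib

open scoped NNReal ENNReal

noncomputable section

/-! ### Weighted transition systems and termination moments -/

/-- Weight of a finite path `s₀ s₁ … s_l`: the product of the weights of its steps
(`1` for a path of length zero). -/
def pathWeight {S : Type*} (M : S → S → ℝ≥0) : List S → ℝ≥0∞
  | [] => 1
  | [_] => 1
  | s :: t :: π => (M s t : ℝ≥0∞) * pathWeight M (t :: π)

/-- `π` is a proper path from `s` to `F`: it starts in `s`, ends in `F`, and visits `F` only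
at its end. For `s ∈ F` the only such path is `[s]`. -/
def IsProperPath {S : Type*} (s : S) (F : Set S) (π : List S) : Prop :=
  π.head? = some s ∧ (∃ t ∈ F, π.getLast? = some t) ∧ ∀ t ∈ π.dropLast, t ∉ F

/-- The `k`-th termination moment: the sum of `p(π) * |π| ^ k` over all proper paths from `s` to
`F`. The length `|π|` of a path is its number of steps; `0 ^ 0 = 1`. -/
def terminationMoment {S : Type*} (M : S → S → ℝ≥0) (k : ℕ) (s : S) (F : Set S) : ℝ≥0∞ :=
  ∑' π : {π : List S // IsProperPath s F π},
    pathWeight M π.1 * ((π.1.length - 1 : ℕ) : ℝ≥0∞) ^ k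

/-! ### Positive polynomial systems -/

/-- A positive polynomial system over the variables `J`: one polynomial with non-negative real
coefficients for each variable. -/
abbrev PPS (J : Type*) := J → MvPolynomial J ℝ≥0

namespace PPS

variable {J : Type*}

/-- The monotone endofunction of `[0,∞]^J` induced by a positive polynomial system. -/
def toFun (f : PPS J) : (J → ℝ≥0∞) →o (J → ℝ≥0∞) where
  toFun u i := (f i).eval₂ ENNReal.ofNNRealHom u
  monotone' := by
    intro u v huv i
    simp only [MvPolynomial.eval₂_eq]
    gcongr with d _ j _
    exact huv j

/-- The least fixed point in `[0,∞]^J`. -/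
def lfp (f : PPS J) : J → ℝ≥0∞ := OrderHom.lfp f.toFun

/-- The indices of the cleaned-up system: the variables that are non-zero in the least fixed
point. -/
def CleanIndex (f : PPS J) : Type _ := {j : J // f.lfp j ≠ 0}

instance (f : PPS J) [Finite J] : Finite f.CleanIndex :=
  inferInstanceAs (Finite {j : J // f.lfp j ≠ 0})

instance (f : PPS J) [Finite J] : Fintype f.CleanIndex := Fintype.ofFinite _

instance (f : PPS J) : DecidableEq f.CleanIndex := Classical.decEq _

open Classical in
/-- The cleaned-up system: the variables that are zero in the least fixed point are removed,
that is, their equations are dropped and they are replaced by `0` in the other equations. -/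
def clean (f : PPS J) : PPS f.CleanIndex := fun i =>
  MvPolynomial.bind₁
    (fun j => if h : f.lfp j ≠ 0 then MvPolynomial.X (⟨j, h⟩ : f.CleanIndex) else 0) (f i.1)

/-- The Jacobi matrix of partial derivatives, evaluated at a finite point `u`. -/
def jacobi (f : PPS J) (u : J → ℝ≥0) : Matrix J J ℝ :=
  Matrix.of fun i j => ((MvPolynomial.eval u (MvPolynomial.pderiv j (f i)) : ℝ≥0) : ℝ)

/-- The Jacobi matrix at the least fixed point. It is meaningful for feasible systems, that is,
when all entries of the least fixed point are finite. -/
def jacobiLfp (f : PPS J) : Matrix J J ℝ := f.jacobi fun j => (f.lfp j).toNNReal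

end PPS

/-! ### Weighted and probabilistic pushdown automata -/

/-- A weighted pushdown automaton with states `Q` and stack alphabet `Γ`; every transition
replaces the top stack symbol by a word of length at most two. Weight `0` means that there is no
transition. -/
structure WeightedPDA (Q Γ : Type*) where
  /-- `pop p Z q` is the weight of the transition from `pZ` to `qε`. -/
  pop : Q → Γ → Q → ℚ≥0
  /-- `swap p Z q Y` is the weight of the transition from `pZ` to `qY`. -/
  swap : Q → Γ → Q → Γ → ℚ≥0
  /-- `push p Z q Y X` is the weight of the transition from `pZ` to `qYX`, with `Y` on top. -/
  push : Q → Γ → Q → Γ → Γ → ℚ≥0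

namespace WeightedPDA

variable {Q Γ : Type*} [Fintype Q] [Fintype Γ]

/-- The weights of the transitions leaving any given `pZ` sum to one. -/
def IsProbabilistic (Δ : WeightedPDA Q Γ) : Prop :=
  ∀ p Z, (∑ q, Δ.pop p Z q) + (∑ q, ∑ Y, Δ.swap p Z q Y)
    + (∑ q, ∑ Y, ∑ X, Δ.push p Z q Y X) = 1

/-- The transition matrix on the configurations `Q × Γ*`; configurations with empty stack have no
outgoing transitions. -/
def transMatrix [DecidableEq Γ] (Δ : WeightedPDA Q Γ) : Q × List Γ → Q × List Γ → ℝ≥0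
  | (_, []), _ => 0
  | (p, Z :: β), (q, γ) =>
      (((if γ = β then Δ.pop p Z q else 0)
        + (∑ Y, if γ = Y :: β then Δ.swap p Z q Y else 0)
        + (∑ Y, ∑ X, if γ = Y :: X :: β then Δ.push p Z q Y X else 0) : ℚ≥0) : ℝ≥0)

/-- The return probability `[pZ|q]`: the zeroth termination moment from `pZ` to `qε`. -/
def returnProb [DecidableEq Γ] (Δ : WeightedPDA Q Γ) (p : Q) (Z : Γ) (q : Q) : ℝ≥0∞ :=
  terminationMoment Δ.transMatrix 0 (p, [Z]) {(q, [])}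

/-- The first termination moment `E[pZ|q]` from `pZ` to `qε`. -/
def firstMoment [DecidableEq Γ] (Δ : WeightedPDA Q Γ) (p : Q) (Z : Γ) (q : Q) : ℝ≥0∞ :=
  terminationMoment Δ.transMatrix 1 (p, [Z]) {(q, [])}

/-- The conditional expected runtime; used only where the return probability is positive. -/
def condRuntime [DecidableEq Γ] (Δ : WeightedPDA Q Γ) (p : Q) (Z : Γ) (q : Q) : ℝ≥0∞ :=
  Δ.firstMoment p Z q / Δ.returnProb p Z q

/-- Conditionally positively almost-surely terminating: all conditional expected runtimes that
are defined are finite. -/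
def IsCPAST [DecidableEq Γ] (Δ : WeightedPDA Q Γ) : Prop :=
  ∀ p Z q, 0 < Δ.returnProb p Z q → Δ.condRuntime p Z q < ⊤

/-- The maximal conditional expected runtime (a supremum over a finite set). -/
def maxCondRuntime [DecidableEq Γ] (Δ : WeightedPDA Q Γ) : ℝ≥0∞ :=
  ⨆ (p : Q) (Z : Γ) (q : Q) (_ : 0 < Δ.returnProb p Z q), Δ.condRuntime p Z q

/-- The minimal non-zero return probability (an infimum over a finite set). -/
def minReturnProb [DecidableEq Γ] (Δ : WeightedPDA Q Γ) : ℝ≥0∞ :=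
  ⨅ (p : Q) (Z : Γ) (q : Q) (_ : 0 < Δ.returnProb p Z q), Δ.returnProb p Z q

/-- The fundamental system: the quadratic system for the return probabilities, with one variable
for each triple `pZq`. -/
def fundamentalPPS (Δ : WeightedPDA Q Γ) : PPS (Q × Γ × Q) := fun ⟨p, Z, q⟩ =>
  MvPolynomial.C (Δ.pop p Z q : ℝ≥0)
    + (∑ r, ∑ Y, MvPolynomial.C (Δ.swap p Z r Y : ℝ≥0) * MvPolynomial.X (r, Y, q))
    + ∑ r, ∑ Y, ∑ X, MvPolynomial.C (Δ.push p Z r Y X : ℝ≥0)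
        * ∑ t, MvPolynomial.X (r, Y, t) * MvPolynomial.X (t, X, q)

/-- The cleaned-up fundamental system. -/
abbrev cleanPPS (Δ : WeightedPDA Q Γ) : PPS Δ.fundamentalPPS.CleanIndex :=
  Δ.fundamentalPPS.clean

end WeightedPDA

/-- Spectral radius of a finite real matrix: the largest absolute value of its complex
eigenvalues. -/
def specRad {J : Type*} [Fintype J] [DecidableEq J] (A : Matrix J J ℝ) : ℝ≥0∞ :=
  spectralRadius ℂ (A.map (algebraMap ℝ ℂ))

/-- The automaton with one state `p`, one stack symbol `Z` and the transitions from `pZ` to `pε`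
with weight `a` and from `pZ` to `pZZ` with weight `1 - a` (for `a ≤ 1`). -/
def branchingPDA (a : ℚ≥0) : WeightedPDA Unit Unit where
  pop _ _ _ := a
  swap _ _ _ _ := 0
  push _ _ _ _ _ := 1 - a

end

/-! Write μ for the return probabilities and E for the first moments, both on the variables that
survive cleaning. The key is the linear system E = μ + f̂'(μ)E (`cleanMoment_eq`). The first step of
a run adds 1 to its length, which contributes μ. A run that empties YX splits into one that empties
Y and one that empties X, and its length is the sum of theirs. Hence first moments obey the product
rule over concatenation (`hitWeight_append`, `runMoment_one_append`), just as the derivative of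
x_{rYt} x_{tXq} does.

Since E ≤ Cμ, this gives f̂'(μ)E = E - μ ≤ (1 - 1/C)E. So v is E divided by its sum. From m ≤ μ ≤ E,
μ ≤ 1 and the number of triples come the bounds on its entries. A positive v with Av ≤ cv bounds the
spectral radius of a non-negative A by c (`specRad_le_of_mulVec_le`). That μ is the least fixed
point is `fundamentalPPS_lfp`, carried over to the cleaned-up system by `clean_lfp`.

For the branching automaton f̂'(μ) is a scalar, and the same linear system determines it once μ = 1
and E = 1/(2a - 1) are known. -/

noncomputable section

/-! ### Path sums by number of steps -/

section PathSums

variable {S : Type*}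

open Classical in
/-- The total weight of the proper paths from `s` to `F` with exactly `n` steps. -/
def properPathSum (M : S → S → ℝ≥0) (F : Set S) (n : ℕ) (s : S) : ℝ≥0∞ :=
  ∑' π : List S, if IsProperPath s F π ∧ π.length = n + 1 then pathWeight M π else 0

theorem IsProperPath.ne_nil {s : S} {F : Set S} {π : List S} (h : IsProperPath s F π) :
    π ≠ [] := by
  rintro rfl
  simpa using h.1

theorem isProperPath_singleton {s t : S} {F : Set S} :
    IsProperPath s F [t] ↔ t = s ∧ s ∈ F := by
  simp only [IsProperPath, List.head?_cons, Option.some.injEq, List.getLast?_singleton,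
    List.dropLast_singleton]
  constructor
  · rintro ⟨rfl, ⟨u, hu, rfl⟩, -⟩
    exact ⟨rfl, hu⟩
  · rintro ⟨rfl, h⟩
    exact ⟨rfl, ⟨_, h, rfl⟩, by simp⟩

theorem isProperPath_cons_cons {s r t : S} {F : Set S} {π : List S} :
    IsProperPath s F (r :: t :: π) ↔ r = s ∧ s ∉ F ∧ IsProperPath t F (t :: π) := by
  simp only [IsProperPath, List.head?_cons, Option.some.injEq, List.getLast?_cons_cons,
    List.dropLast_cons_cons, List.mem_cons, true_and]
  constructor
  · rintro ⟨rfl, h, h'⟩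
    exact ⟨rfl, h' _ (Or.inl rfl), h, fun u hu => h' u (Or.inr hu)⟩
  · rintro ⟨rfl, h, h', h''⟩
    refine ⟨rfl, h', ?_⟩
    rintro u (rfl | hu)
    · exact h
    · exact h'' u hu

theorem terminationMoment_eq_tsum (M : S → S → ℝ≥0) (k : ℕ) (s : S) (F : Set S) :
    terminationMoment M k s F = ∑' n : ℕ, properPathSum M F n s * (n : ℝ≥0∞) ^ k := by
  classical
  have h1 : terminationMoment M k s F = ∑' π : List S,
      if IsProperPath s F π then pathWeight M π * ((π.length - 1 : ℕ) : ℝ≥0∞) ^ k else 0 := by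
    rw [terminationMoment]
    exact (tsum_subtype {π : List S | IsProperPath s F π}
      (fun π => pathWeight M π * ((π.length - 1 : ℕ) : ℝ≥0∞) ^ k)).trans
        (by simp [Set.indicator_apply])
  rw [h1]
  simp only [properPathSum, ← ENNReal.tsum_mul_right]
  rw [ENNReal.tsum_comm]
  refine tsum_congr fun π => ?_
  -- Each list counts for one `n` only. The truncated subtraction is harmless because the empty list
  -- is not a proper path.
  rw [tsum_eq_single (π.length - 1)]
  · by_cases h : IsProperPath s F π
    · have := List.length_pos_iff.mpr h.ne_nil
      rw [if_pos h, if_pos ⟨h, by omega⟩]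
    · simp [h]
  · intro n hn
    rw [if_neg, zero_mul]
    rintro ⟨-, h⟩
    omega

open Classical in
theorem properPathSum_zero (M : S → S → ℝ≥0) (F : Set S) (s : S) :
    properPathSum M F 0 s = if s ∈ F then 1 else 0 := by
  rw [properPathSum, tsum_eq_single [s]]
  · simp [isProperPath_singleton, pathWeight]
  · intro π hπ
    rw [if_neg]
    rintro ⟨h, hl⟩
    obtain ⟨t, rfl⟩ := List.length_eq_one_iff.mp hl
    exact hπ (by rw [(isProperPath_singleton.mp h).1])

open Classical in
theorem properPathSum_succ (M : S → S → ℝ≥0) (F : Set S) (n : ℕ) (s : S) :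
    properPathSum M F (n + 1) s
      = if s ∈ F then 0 else ∑' t, (M s t : ℝ≥0∞) * properPathSum M F n t := by
  rw [properPathSum]
  have hinj : Function.Injective (fun π : List S => s :: π) := List.cons_injective
  -- Only lists of the form `s :: π` contribute, so the sum may run over their tails.
  rw [← hinj.tsum_eq]
  · split_ifs with hs
    · rw [ENNReal.tsum_eq_zero]
      rintro (_ | ⟨t, π⟩)
      · simp
      · simp [isProperPath_cons_cons, hs]
    · simp only [properPathSum, ← ENNReal.tsum_mul_left]
      rw [ENNReal.tsum_comm]
      refine tsum_congr fun π => ?_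
      rcases π with _ | ⟨t, π⟩
      · simp
      · rw [tsum_eq_single t]
        · simp [isProperPath_cons_cons, hs, pathWeight]
        · intro u hu
          rw [if_neg, mul_zero]
          rintro ⟨h, -⟩
          exact hu (by simpa using h.1.symm)
  · intro π hπ
    have h : IsProperPath s F π := by
      by_contra h
      simp [h] at hπ
    rcases π with _ | ⟨t, π⟩
    · simpa using h.1
    · have : t = s := by simpa using h.1
      exact ⟨π, by rw [this]⟩

end PathSums

/-! ### Weights of runs of a pushdown automaton -/

namespace WeightedPDA

variable {Q Γ : Type*}

/-- The right-hand sides of transitions: a state together with a word of length at most two. -/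
abbrev Move (Q Γ : Type*) := Q × Option (Γ × Option Γ)

/-- The word that a transition puts on the stack. -/
def Move.word (m : Move Q Γ) : List Γ :=
  match m.2 with
  | none => []
  | some (Y, none) => [Y]
  | some (Y, some X) => [Y, X]

/-- The weight of a transition. -/
def moveWeight (Δ : WeightedPDA Q Γ) (p : Q) (Z : Γ) (m : Move Q Γ) : ℝ≥0 :=
  match m.2 with
  | none => Δ.pop p Z m.1
  | some (Y, none) => Δ.swap p Z m.1 Y
  | some (Y, some X) => Δ.push p Z m.1 Y X

variable [Fintype Q] [Fintype Γ]

theorem sum_move {A : Type*} [AddCommMonoid A] (F : Move Q Γ → A) :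
    ∑ m, F m = (∑ r, F (r, none)) + (∑ r, ∑ Y, F (r, some (Y, none)))
      + ∑ r, ∑ Y, ∑ X, F (r, some (Y, some X)) := by
  simp only [Fintype.sum_prod_type, Fintype.sum_option, Finset.sum_add_distrib, add_assoc]

open Classical in
/-- The total weight of the runs with exactly `n` steps from `pα` to `qε`. -/
def hitWeight (Δ : WeightedPDA Q Γ) : ℕ → Q → List Γ → Q → ℝ≥0∞
  | 0, p, [], q => if p = q then 1 else 0
  | 0, _, _ :: _, _ => 0
  | _ + 1, _, [], _ => 0
  | n + 1, p, Z :: β, q => ∑ m : Move Q Γ, (Δ.moveWeight p Z m : ℝ≥0∞) *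
      hitWeight Δ n m.1 (m.word ++ β) q

theorem tsum_ite_eq_mul {A : Type*} [DecidableEq A] (b : A) (c : ℝ≥0) (F : A → ℝ≥0∞) :
    ∑' a, ((if a = b then c else 0 : ℝ≥0) : ℝ≥0∞) * F a = c * F b := by
  rw [tsum_eq_single b]
  · simp
  · intro a ha
    simp [ha]

/-- This trades the series over infinitely many configurations for a finite sum over transitions, so
that later inductions follow the stack only. -/
theorem tsum_transMatrix_mul [DecidableEq Γ] (Δ : WeightedPDA Q Γ) (p : Q) (Z : Γ) (β : List Γ)
    (F : Q × List Γ → ℝ≥0∞) :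
    ∑' t, (Δ.transMatrix (p, Z :: β) t : ℝ≥0∞) * F t
      = ∑ m : Move Q Γ, (Δ.moveWeight p Z m : ℝ≥0∞) * F (m.1, m.word ++ β) := by
  rw [ENNReal.tsum_prod', tsum_fintype, sum_move, ← Finset.sum_add_distrib,
    ← Finset.sum_add_distrib]
  refine Finset.sum_congr rfl fun r _ => ?_
  have h : ∀ γ, (Δ.transMatrix (p, Z :: β) (r, γ) : ℝ≥0∞) * F (r, γ)
      = ((if γ = β then (Δ.pop p Z r : ℝ≥0) else 0 : ℝ≥0) : ℝ≥0∞) * F (r, γ)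
        + (∑ Y, ((if γ = Y :: β then (Δ.swap p Z r Y : ℝ≥0) else 0 : ℝ≥0) : ℝ≥0∞) * F (r, γ))
        + ∑ Y, ∑ X, ((if γ = Y :: X :: β then (Δ.push p Z r Y X : ℝ≥0) else 0 : ℝ≥0) : ℝ≥0∞)
          * F (r, γ) := by
    intro γ
    simp only [transMatrix, NNRat.cast_add, NNRat.cast_sum, ENNReal.coe_add, ENNReal.ofNNReal_finsetSum,
      add_mul, Finset.sum_mul, apply_ite (NNRat.cast : ℚ≥0 → ℝ≥0), NNRat.cast_zero]
  simp only [h, ENNReal.tsum_add, Summable.tsum_finsetSum fun _ _ => ENNReal.summable,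
    tsum_ite_eq_mul]
  rfl

theorem properPathSum_transMatrix [DecidableEq Γ] (Δ : WeightedPDA Q Γ) (n : ℕ) (p : Q)
    (α : List Γ) (q : Q) :
    properPathSum Δ.transMatrix {(q, [])} n (p, α) = Δ.hitWeight n p α q := by
  classical
  induction n generalizing p α with
  | zero => cases α <;> simp [properPathSum_zero, hitWeight]
  | succ n ih =>
    rw [properPathSum_succ]
    cases α with
    | nil => simp [hitWeight, transMatrix]
    | cons Z β =>
      rw [if_neg (by simp), tsum_transMatrix_mul]
      simp only [ih, hitWeight]

/-- The `k`-th moment of the number of steps of the runs from `pα` to `qε`. -/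
def runMoment (Δ : WeightedPDA Q Γ) (k : ℕ) (p : Q) (α : List Γ) (q : Q) : ℝ≥0∞ :=
  ∑' n : ℕ, Δ.hitWeight n p α q * (n : ℝ≥0∞) ^ k

theorem returnProb_eq [DecidableEq Γ] (Δ : WeightedPDA Q Γ) (p : Q) (Z : Γ) (q : Q) :
    Δ.returnProb p Z q = Δ.runMoment 0 p [Z] q := by
  simp only [returnProb, terminationMoment_eq_tsum, properPathSum_transMatrix, runMoment]

theorem firstMoment_eq [DecidableEq Γ] (Δ : WeightedPDA Q Γ) (p : Q) (Z : Γ) (q : Q) :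
    Δ.firstMoment p Z q = Δ.runMoment 1 p [Z] q := by
  simp only [firstMoment, terminationMoment_eq_tsum, properPathSum_transMatrix, runMoment]

end WeightedPDA

namespace WeightedPDA

variable {Q Γ : Type*} [Fintype Q]

/-! ### Multiplicative extensions -/

open Classical in
/-- The extension of a vector indexed by triples `pZq` to all stack contents, multiplicative under
concatenation. -/
def wordExt (u : Q × Γ × Q → ℝ≥0∞) : Q → List Γ → Q → ℝ≥0∞
  | p, [], q => if p = q then 1 else 0
  | p, Z :: β, q => ∑ t, u (p, Z, t) * wordExt u t β q

theorem wordExt_append (u : Q × Γ × Q → ℝ≥0∞) (p : Q) (α β : List Γ) (q : Q) :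
    wordExt u p (α ++ β) q = ∑ t, wordExt u p α t * wordExt u t β q := by
  classical
  induction α generalizing p with
  | nil => simp [wordExt]
  | cons Z α ih =>
    simp only [List.cons_append, wordExt, ih, Finset.mul_sum, Finset.sum_mul]
    rw [Finset.sum_comm]
    simp only [mul_assoc]

theorem wordExt_singleton (u : Q × Γ × Q → ℝ≥0∞) (p : Q) (Z : Γ) (q : Q) :
    wordExt u p [Z] q = u (p, Z, q) := by
  classical
  simp [wordExt]

/-! ### Moments of runs -/

variable [Fintype Γ]

theorem hitWeight_zero_cons (Δ : WeightedPDA Q Γ) (p : Q) (Z : Γ) (β : List Γ) (q : Q) :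
    Δ.hitWeight 0 p (Z :: β) q = 0 := by simp [hitWeight]

theorem hitWeight_succ_cons (Δ : WeightedPDA Q Γ) (n : ℕ) (p : Q) (Z : Γ) (β : List Γ) (q : Q) :
    Δ.hitWeight (n + 1) p (Z :: β) q = ∑ m : Move Q Γ, (Δ.moveWeight p Z m : ℝ≥0∞) *
      Δ.hitWeight n m.1 (m.word ++ β) q := by simp [hitWeight]

theorem hitWeight_nil_append (Δ : WeightedPDA Q Γ) (n : ℕ) (p : Q) (β : List Γ) (q : Q) :
    Δ.hitWeight n p β q = ∑ t, ∑ x ∈ Finset.HasAntidiagonal.antidiagonal n,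
      Δ.hitWeight x.1 p [] t * Δ.hitWeight x.2 t β q := by
  classical
  have h : ∀ t, ∑ x ∈ Finset.HasAntidiagonal.antidiagonal n,
      Δ.hitWeight x.1 p [] t * Δ.hitWeight x.2 t β q
      = if p = t then Δ.hitWeight n t β q else 0 := by
    intro t
    cases n with
    | zero => simp [hitWeight]
    | succ n => simp [Finset.Nat.sum_antidiagonal_succ, hitWeight]
  simp [h]

/-- A run that empties the stack `αβ` first empties `α`, then `β`. -/
theorem hitWeight_append (Δ : WeightedPDA Q Γ) (n : ℕ) (p : Q) (α β : List Γ) (q : Q) :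
    Δ.hitWeight n p (α ++ β) q = ∑ t, ∑ x ∈ Finset.HasAntidiagonal.antidiagonal n,
      Δ.hitWeight x.1 p α t * Δ.hitWeight x.2 t β q := by
  induction n generalizing p α with
  | zero =>
    cases α with
    | nil => exact hitWeight_nil_append Δ 0 p β q
    | cons Z α => simp [hitWeight]
  | succ n ih =>
    cases α with
    | nil => exact hitWeight_nil_append Δ (n + 1) p β q
    | cons Z α =>
      -- No run of zero steps empties a non-empty stack, so the first antidiagonal term vanishes and
      -- the rest is shifted by one step.
      simp only [List.cons_append, hitWeight_succ_cons, Finset.Nat.sum_antidiagonal_succ,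
        hitWeight_zero_cons, zero_mul, zero_add]
      simp only [← List.append_assoc, ih, Finset.mul_sum, Finset.sum_mul]
      rw [Finset.sum_comm]
      refine Finset.sum_congr rfl fun t _ => ?_
      rw [Finset.sum_comm]
      simp only [mul_assoc]

theorem tsum_sum_antidiagonal (F : ℕ × ℕ → ℝ≥0∞) :
    ∑' n, ∑ x ∈ Finset.HasAntidiagonal.antidiagonal n, F x = ∑' i, ∑' j, F (i, j) := by
  rw [← ENNReal.tsum_prod', ← Finset.HasAntidiagonal.sigmaAntidiagonalEquivProd.tsum_eq, ENNReal.tsum_sigma']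
  refine tsum_congr fun n => ?_
  rw [tsum_fintype, ← Finset.sum_coe_sort]
  rfl

theorem runMoment_zero (Δ : WeightedPDA Q Γ) (p : Q) (α : List Γ) (q : Q) :
    Δ.runMoment 0 p α q = ∑' n, Δ.hitWeight n p α q := by simp [runMoment]

theorem runMoment_one (Δ : WeightedPDA Q Γ) (p : Q) (α : List Γ) (q : Q) :
    Δ.runMoment 1 p α q = ∑' n, Δ.hitWeight n p α q * n := by simp [runMoment]

theorem runMoment_zero_append (Δ : WeightedPDA Q Γ) (p : Q) (α β : List Γ) (q : Q) :
    Δ.runMoment 0 p (α ++ β) q = ∑ t, Δ.runMoment 0 p α t * Δ.runMoment 0 t β q := by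
  simp only [runMoment_zero, hitWeight_append]
  rw [Summable.tsum_finsetSum fun _ _ => ENNReal.summable]
  refine Finset.sum_congr rfl fun t _ => ?_
  rw [tsum_sum_antidiagonal (fun x => Δ.hitWeight x.1 p α t * Δ.hitWeight x.2 t β q)]
  simp only [ENNReal.tsum_mul_left, ENNReal.tsum_mul_right]

/-- Lengths add along a concatenation, so weighting by i + j yields a Leibniz rule. -/
theorem runMoment_one_append (Δ : WeightedPDA Q Γ) (p : Q) (α β : List Γ) (q : Q) :
    Δ.runMoment 1 p (α ++ β) q = ∑ t, (Δ.runMoment 1 p α t * Δ.runMoment 0 t β q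
      + Δ.runMoment 0 p α t * Δ.runMoment 1 t β q) := by
  simp only [runMoment_zero, runMoment_one, hitWeight_append, Finset.sum_mul]
  rw [Summable.tsum_finsetSum fun _ _ => ENNReal.summable]
  refine Finset.sum_congr rfl fun t _ => ?_
  have h : ∀ n : ℕ, ∑ x ∈ Finset.HasAntidiagonal.antidiagonal n,
      Δ.hitWeight x.1 p α t * Δ.hitWeight x.2 t β q * (n : ℝ≥0∞)
      = ∑ x ∈ Finset.HasAntidiagonal.antidiagonal n, (Δ.hitWeight x.1 p α t * x.1 * Δ.hitWeight x.2 t β q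
        + Δ.hitWeight x.1 p α t * (Δ.hitWeight x.2 t β q * x.2)) := by
    intro n
    refine Finset.sum_congr rfl fun x hx => ?_
    rw [← Finset.HasAntidiagonal.mem_antidiagonal.mp hx]
    push_cast
    ring
  simp only [h]
  rw [tsum_sum_antidiagonal (fun x => Δ.hitWeight x.1 p α t * x.1 * Δ.hitWeight x.2 t β q
        + Δ.hitWeight x.1 p α t * (Δ.hitWeight x.2 t β q * x.2))]
  simp only [ENNReal.tsum_add, ENNReal.tsum_mul_left, ENNReal.tsum_mul_right]

open Classical in
theorem runMoment_zero_nil (Δ : WeightedPDA Q Γ) (p q : Q) :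
    Δ.runMoment 0 p [] q = if p = q then 1 else 0 := by
  rw [runMoment_zero, tsum_eq_zero_add' ENNReal.summable]
  simp [hitWeight]

theorem runMoment_one_nil (Δ : WeightedPDA Q Γ) (p q : Q) :
    Δ.runMoment 1 p [] q = 0 := by
  rw [runMoment_one, tsum_eq_zero_add' ENNReal.summable]
  simp [hitWeight]

theorem runMoment_zero_cons (Δ : WeightedPDA Q Γ) (p : Q) (Z : Γ) (β : List Γ) (q : Q) :
    Δ.runMoment 0 p (Z :: β) q = ∑ m : Move Q Γ, (Δ.moveWeight p Z m : ℝ≥0∞) *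
      Δ.runMoment 0 m.1 (m.word ++ β) q := by
  simp only [runMoment_zero]
  rw [tsum_eq_zero_add' ENNReal.summable]
  simp only [hitWeight_zero_cons, hitWeight_succ_cons, zero_add]
  rw [Summable.tsum_finsetSum fun _ _ => ENNReal.summable]
  simp only [ENNReal.tsum_mul_left]

/-- Splitting the factor n + 1 makes the first step contribute the zeroth moment, the inhomogeneous
term of the linear system. -/
theorem runMoment_one_cons (Δ : WeightedPDA Q Γ) (p : Q) (Z : Γ) (β : List Γ) (q : Q) :
    Δ.runMoment 1 p (Z :: β) q = Δ.runMoment 0 p (Z :: β) q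
      + ∑ m : Move Q Γ, (Δ.moveWeight p Z m : ℝ≥0∞) * Δ.runMoment 1 m.1 (m.word ++ β) q := by
  rw [runMoment_zero_cons]
  simp only [runMoment_zero, runMoment_one]
  rw [tsum_eq_zero_add' ENNReal.summable]
  simp only [hitWeight_zero_cons, hitWeight_succ_cons, zero_add, Nat.cast_add, Nat.cast_one,
    mul_add, mul_one, zero_mul, ENNReal.tsum_add, Finset.sum_mul]
  rw [Summable.tsum_finsetSum fun _ _ => ENNReal.summable,
    Summable.tsum_finsetSum fun _ _ => ENNReal.summable, add_comm]
  simp only [ENNReal.tsum_mul_left, mul_assoc]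

theorem runMoment_zero_le_one_of_cons (Δ : WeightedPDA Q Γ) (p : Q) (Z : Γ) (β : List Γ) (q : Q) :
    Δ.runMoment 0 p (Z :: β) q ≤ Δ.runMoment 1 p (Z :: β) q := by
  rw [runMoment_one_cons]
  exact le_self_add

/-- Ensures that cleaning up loses no first moment. -/
theorem runMoment_one_eq_zero (Δ : WeightedPDA Q Γ) {p : Q} {α : List Γ} {q : Q}
    (h : Δ.runMoment 0 p α q = 0) : Δ.runMoment 1 p α q = 0 := by
  rw [runMoment_zero, ENNReal.tsum_eq_zero] at h
  simp [runMoment_one, h]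

/-! ### Bounds for probabilistic automata -/

theorem sum_moveWeight {Δ : WeightedPDA Q Γ} (hΔ : Δ.IsProbabilistic) (p : Q) (Z : Γ) :
    ∑ m, (Δ.moveWeight p Z m : ℝ≥0∞) = 1 := by
  rw [sum_move]
  simp only [moveWeight]
  have h := congrArg (fun x : ℚ≥0 => ((x : ℝ≥0) : ℝ≥0∞)) (hΔ p Z)
  simpa only [NNRat.cast_add, NNRat.cast_sum, ENNReal.coe_add, ENNReal.ofNNReal_finsetSum,
    NNRat.cast_one, ENNReal.coe_one] using h

/-- The total probability of emptying the stack within a finite horizon is at most 1. The finite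
horizon permits induction on it, for all stacks at once. -/
theorem sum_hitWeight_le_one {Δ : WeightedPDA Q Γ} (hΔ : Δ.IsProbabilistic) (N : ℕ) (p : Q)
    (α : List Γ) : ∑ n ∈ Finset.range N, ∑ q, Δ.hitWeight n p α q ≤ 1 := by
  classical
  induction N generalizing p α with
  | zero => simp
  | succ N ih =>
    rw [Finset.sum_range_succ']
    cases α with
    | nil => simp [hitWeight]
    | cons Z β =>
      simp only [hitWeight_succ_cons, hitWeight_zero_cons, Finset.sum_const_zero, add_zero]
      calc ∑ n ∈ Finset.range N, ∑ q, ∑ m : Move Q Γ, (Δ.moveWeight p Z m : ℝ≥0∞) *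
              Δ.hitWeight n m.1 (m.word ++ β) q
          = ∑ m : Move Q Γ, (Δ.moveWeight p Z m : ℝ≥0∞) *
              ∑ n ∈ Finset.range N, ∑ q, Δ.hitWeight n m.1 (m.word ++ β) q := by
            simp only [Finset.mul_sum]
            refine Eq.trans (Finset.sum_congr rfl fun n _ => Finset.sum_comm) Finset.sum_comm
        _ ≤ ∑ m : Move Q Γ, (Δ.moveWeight p Z m : ℝ≥0∞) * 1 := by
            gcongr with m _
            exact ih _ _
        _ = 1 := by simp only [mul_one, sum_moveWeight hΔ]

theorem runMoment_zero_le_one {Δ : WeightedPDA Q Γ} (hΔ : Δ.IsProbabilistic) (p : Q)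
    (α : List Γ) (q : Q) : Δ.runMoment 0 p α q ≤ 1 := by
  rw [runMoment_zero, ENNReal.tsum_eq_iSup_nat]
  refine iSup_le fun N => le_trans (Finset.sum_le_sum fun n _ => ?_) (sum_hitWeight_le_one hΔ N p α)
  exact Finset.single_le_sum (f := fun q => Δ.hitWeight n p α q) (fun _ _ => zero_le)
    (Finset.mem_univ q)

/-! ### The least fixed point of the fundamental system -/

theorem fundamentalPPS_toFun (Δ : WeightedPDA Q Γ) (u : Q × Γ × Q → ℝ≥0∞) (p : Q) (Z : Γ)
    (q : Q) : Δ.fundamentalPPS.toFun u (p, Z, q)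
      = ((Δ.pop p Z q : ℝ≥0) : ℝ≥0∞)
        + (∑ r, ∑ Y, ((Δ.swap p Z r Y : ℝ≥0) : ℝ≥0∞) * u (r, Y, q))
        + ∑ r, ∑ Y, ∑ X, ((Δ.push p Z r Y X : ℝ≥0) : ℝ≥0∞)
          * ∑ t, u (r, Y, t) * u (t, X, q) := by
  change ((Δ.fundamentalPPS (p, Z, q)).eval₂ ENNReal.ofNNRealHom u) = _
  simp only [fundamentalPPS, MvPolynomial.eval₂_add, MvPolynomial.eval₂_sum, MvPolynomial.eval₂_mul,
    MvPolynomial.eval₂_C, MvPolynomial.eval₂_X]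
  rfl

theorem sum_moveWeight_mul_wordExt (Δ : WeightedPDA Q Γ) (u : Q × Γ × Q → ℝ≥0∞) (p : Q) (Z : Γ)
    (q : Q) : ∑ m : Move Q Γ, (Δ.moveWeight p Z m : ℝ≥0∞) * wordExt u m.1 m.word q
      = Δ.fundamentalPPS.toFun u (p, Z, q) := by
  classical
  rw [sum_move, fundamentalPPS_toFun]
  simp [moveWeight, Move.word, wordExt]

/-- Truncated return weights stay below every pre-fixed point. Induction needs arbitrary stacks
because a push lengthens the stack; multiplicativity of `wordExt` then reduces the step to the top
symbol. -/
theorem sum_hitWeight_le_wordExt (Δ : WeightedPDA Q Γ) {u : Q × Γ × Q → ℝ≥0∞}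
    (hu : Δ.fundamentalPPS.toFun u ≤ u) (N : ℕ) (p : Q) (α : List Γ) (q : Q) :
    ∑ n ∈ Finset.range N, Δ.hitWeight n p α q ≤ wordExt u p α q := by
  classical
  induction N generalizing p α with
  | zero => simp
  | succ N ih =>
    rw [Finset.sum_range_succ']
    cases α with
    | nil => simp [hitWeight, wordExt]
    | cons Z β =>
      simp only [hitWeight_succ_cons, hitWeight_zero_cons, add_zero]
      rw [Finset.sum_comm]
      simp only [← Finset.mul_sum]
      calc ∑ m : Move Q Γ, (Δ.moveWeight p Z m : ℝ≥0∞) *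
              ∑ n ∈ Finset.range N, Δ.hitWeight n m.1 (m.word ++ β) q
          ≤ ∑ m : Move Q Γ, (Δ.moveWeight p Z m : ℝ≥0∞) * wordExt u m.1 (m.word ++ β) q := by
            gcongr with m _
            exact ih _ _
        _ = ∑ t, Δ.fundamentalPPS.toFun u (p, Z, t) * wordExt u t β q := by
            simp only [← sum_moveWeight_mul_wordExt, wordExt_append, Finset.mul_sum, Finset.sum_mul]
            rw [Finset.sum_comm]
            simp only [mul_assoc]
        _ ≤ wordExt u p (Z :: β) q := by
            simp only [wordExt]
            gcongr with t _
            exact hu _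

theorem runMoment_zero_eq_wordExt (Δ : WeightedPDA Q Γ) (p : Q) (α : List Γ) (q : Q) :
    Δ.runMoment 0 p α q = wordExt (fun j => Δ.runMoment 0 j.1 [j.2.1] j.2.2) p α q := by
  induction α generalizing p with
  | nil => simp [wordExt, runMoment_zero_nil]
  | cons Z β ih =>
    rw [← List.singleton_append, runMoment_zero_append]
    simp only [List.singleton_append, wordExt, ih]

theorem fundamentalPPS_lfp (Δ : WeightedPDA Q Γ) (p : Q) (Z : Γ) (q : Q) :
    Δ.fundamentalPPS.lfp (p, Z, q) = Δ.runMoment 0 p [Z] q := by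
  apply le_antisymm
  -- The zeroth moments form a fixed point, by the first-step equation and multiplicativity. The
  -- converse bound is the limit of the truncations.
  · refine (OrderHom.lfp_le Δ.fundamentalPPS.toFun
      (a := fun j => Δ.runMoment 0 j.1 [j.2.1] j.2.2) ?_) (p, Z, q)
    rintro ⟨p, Z, q⟩
    rw [← sum_moveWeight_mul_wordExt]
    simp only [← runMoment_zero_eq_wordExt, runMoment_zero_cons Δ p Z [] q, List.append_nil,
      le_refl]
  · rw [runMoment_zero, ENNReal.tsum_eq_iSup_nat]
    refine iSup_le fun N => ?_
    rw [← wordExt_singleton Δ.fundamentalPPS.lfp]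
    exact sum_hitWeight_le_wordExt Δ (OrderHom.map_lfp _).le N p [Z] q

theorem firstMoment_recursion (Δ : WeightedPDA Q Γ) (p : Q) (Z : Γ) (q : Q) :
    Δ.runMoment 1 p [Z] q = Δ.runMoment 0 p [Z] q
      + ((∑ r, ∑ Y, ((Δ.swap p Z r Y : ℝ≥0) : ℝ≥0∞) * Δ.runMoment 1 r [Y] q)
        + ∑ r, ∑ Y, ∑ X, ((Δ.push p Z r Y X : ℝ≥0) : ℝ≥0∞)
          * ∑ t, (Δ.runMoment 1 r [Y] t * Δ.runMoment 0 t [X] q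
            + Δ.runMoment 0 r [Y] t * Δ.runMoment 1 t [X] q)) := by
  rw [runMoment_one_cons, sum_move]
  simp only [moveWeight, Move.word, List.append_nil, runMoment_one_nil, mul_zero,
    Finset.sum_const_zero, zero_add, ← runMoment_one_append, List.singleton_append]

end WeightedPDA

/-! ### Cleaned-up systems -/

namespace PPS

variable {J : Type*}

open Classical in
/-- The extension of a vector by zero to the variables removed by cleaning up. -/
def extendZero {R : Type*} [Zero R] (f : PPS J) (u : f.CleanIndex → R) (j : J) : R :=
  if h : f.lfp j ≠ 0 then u ⟨j, h⟩ else 0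

theorem extendZero_of_ne {R : Type*} [Zero R] (f : PPS J) (u : f.CleanIndex → R) {j : J}
    (h : f.lfp j ≠ 0) : f.extendZero u j = u (⟨j, h⟩ : f.CleanIndex) :=
  dif_pos h

theorem extendZero_of_eq {R : Type*} [Zero R] (f : PPS J) (u : f.CleanIndex → R) {j : J}
    (h : f.lfp j = 0) : f.extendZero u j = 0 :=
  dif_neg (not_not.mpr h)

theorem clean_toFun (f : PPS J) (u : f.CleanIndex → ℝ≥0∞) (i : f.CleanIndex) :
    f.clean.toFun u i = f.toFun (f.extendZero u) i.1 := by
  change (f.clean i).eval₂ ENNReal.ofNNRealHom u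
    = (f i.1).eval₂ ENNReal.ofNNRealHom (f.extendZero u)
  refine (MvPolynomial.eval₂Hom_bind₁ ENNReal.ofNNRealHom u _ (f i.1)).trans ?_
  rw [MvPolynomial.coe_eval₂Hom]
  congr 1
  funext j
  unfold extendZero
  split_ifs
  · exact MvPolynomial.eval₂_X ENNReal.ofNNRealHom u _
  · exact map_zero (MvPolynomial.eval₂Hom ENNReal.ofNNRealHom u)

theorem clean_lfp (f : PPS J) (i : f.CleanIndex) : f.clean.lfp i = f.lfp i.1 := by
  have hfix : f.toFun f.lfp = f.lfp := OrderHom.map_lfp f.toFun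
  have hres : f.extendZero (fun i : f.CleanIndex => f.lfp i.1) = f.lfp := by
    funext j
    unfold extendZero
    split_ifs with h
    · rfl
    · exact (not_not.mp h).symm
  have hle : ∀ i : f.CleanIndex, f.clean.lfp i ≤ f.lfp i.1 := by
    refine OrderHom.lfp_le f.clean.toFun (a := fun i : f.CleanIndex => f.lfp i.1) fun i => ?_
    rw [clean_toFun, hres, hfix]
  refine le_antisymm (hle i) ?_
  have hext : f.extendZero f.clean.lfp ≤ f.lfp := by
    intro j
    unfold extendZero
    split_ifs with h
    · exact hle ⟨j, h⟩
    · exact zero_le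
  refine le_trans ?_ (f.extendZero_of_ne f.clean.lfp i.2).le
  refine (OrderHom.lfp_le f.toFun (a := f.extendZero f.clean.lfp) fun j => ?_) i.1
  by_cases h : f.lfp j ≠ 0
  · have h1 := f.clean_toFun f.clean.lfp ⟨j, h⟩
    have h2 : f.clean.toFun f.clean.lfp = f.clean.lfp := OrderHom.map_lfp f.clean.toFun
    rw [h2] at h1
    rw [← h1]
    exact (f.extendZero_of_ne f.clean.lfp h).ge
  -- At a removed variable monotonicity bounds the value by the least fixed point, which is 0 there.
  -- So the zero extension is a pre-fixed point of `f`.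
  · have := f.toFun.monotone hext j
    rw [hfix, not_not.mp h] at this
    exact this.trans zero_le

end PPS

/-! ### Directional derivatives of polynomials -/

section DirDeriv

variable {I : Type*} [Fintype I]

/-- The derivative of a polynomial at `u` in the direction `e`. -/
def dirDeriv (u e : I → ℝ≥0) (P : MvPolynomial I ℝ≥0) : ℝ≥0 :=
  ∑ j, MvPolynomial.eval u (MvPolynomial.pderiv j P) * e j

variable (u e : I → ℝ≥0)

theorem dirDeriv_C (c : ℝ≥0) : dirDeriv u e (MvPolynomial.C c) = 0 := by
  simp [dirDeriv]

theorem dirDeriv_zero : dirDeriv u e 0 = 0 := by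
  simp [dirDeriv]

theorem dirDeriv_X (i : I) : dirDeriv u e (MvPolynomial.X i) = e i := by
  classical
  simp [dirDeriv, MvPolynomial.pderiv_X, Pi.single_apply, apply_ite (MvPolynomial.eval u)]

theorem dirDeriv_add (P P' : MvPolynomial I ℝ≥0) :
    dirDeriv u e (P + P') = dirDeriv u e P + dirDeriv u e P' := by
  simp [dirDeriv, add_mul, Finset.sum_add_distrib]

theorem dirDeriv_sum {A : Type*} (s : Finset A) (P : A → MvPolynomial I ℝ≥0) :
    dirDeriv u e (∑ a ∈ s, P a) = ∑ a ∈ s, dirDeriv u e (P a) := by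
  simp only [dirDeriv, map_sum, Finset.sum_mul]
  exact Finset.sum_comm

theorem dirDeriv_mul (P P' : MvPolynomial I ℝ≥0) :
    dirDeriv u e (P * P') = dirDeriv u e P * MvPolynomial.eval u P'
      + MvPolynomial.eval u P * dirDeriv u e P' := by
  simp only [dirDeriv, Derivation.leibniz, smul_eq_mul, map_add, map_mul, add_mul,
    Finset.sum_add_distrib, Finset.sum_mul, Finset.mul_sum]
  rw [add_comm]
  congr 1 <;> refine Finset.sum_congr rfl fun j _ => by ring

/-- Only the product with one vector matters, so the Leibniz rule for `dirDeriv` replaces any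
computation of matrix entries. -/
theorem jacobi_mulVec (f : PPS I) (i : I) :
    (f.jacobi u).mulVec (fun j => (e j : ℝ)) i = (dirDeriv u e (f i) : ℝ) := by
  simp [PPS.jacobi, Matrix.mulVec, dotProduct, dirDeriv]

end DirDeriv

/-! ### Spectral radius -/

/-- A non-negative matrix with a positive vector `v` such that `A v ≤ c v` has spectral radius at
most `c`. -/
theorem specRad_le_of_mulVec_le {I : Type*} [Fintype I] [DecidableEq I] {A : Matrix I I ℝ}
    (hA : ∀ i j, 0 ≤ A i j) {v : I → ℝ} (hv : ∀ i, 0 < v i) {c : ℝ}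
    (h : ∀ i, A.mulVec v i ≤ c * v i) : specRad A ≤ ENNReal.ofReal c := by
  rw [specRad, spectralRadius]
  refine iSup₂_le fun k hk => ?_
  rw [← Matrix.spectrum_toLin', ← Module.End.hasEigenvalue_iff_mem_spectrum] at hk
  obtain ⟨x, hx⟩ := hk.exists_hasEigenvector
  have hx0 : x ≠ 0 := hx.2
  have hkx : ∀ i, k * x i = ∑ j, (A i j : ℂ) * x j := by
    intro i
    have := congrFun hx.apply_eq_smul i
    simpa [Matrix.toLin'_apply, Matrix.mulVec, dotProduct] using this.symm
  obtain ⟨i₀, hi₀⟩ : ∃ i, x i ≠ 0 := Function.ne_iff.mp hx0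
  -- At the index maximising |x_i|/v_i, the eigenvalue equation is compared with Av ≤ cv: this is
  -- the sup-norm weighted by `v`.
  obtain ⟨i, -, hi⟩ := Finset.exists_max_image Finset.univ (fun i => ‖x i‖ / v i)
    ⟨i₀, Finset.mem_univ _⟩
  set t := ‖x i‖ / v i with ht
  have htpos : 0 < t :=
    (div_pos (norm_pos_iff.mpr hi₀) (hv i₀)).trans_le (hi i₀ (Finset.mem_univ _))
  have hxj : ∀ j, ‖x j‖ ≤ t * v j := fun j => (div_le_iff₀ (hv j)).mp (hi j (Finset.mem_univ _))
  have hxi : ‖x i‖ = t * v i := by rw [ht, div_mul_cancel₀ _ (hv i).ne']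
  have hle : ‖k‖ * (t * v i) ≤ c * (t * v i) := by
    calc ‖k‖ * (t * v i) = ‖∑ j, (A i j : ℂ) * x j‖ := by rw [← hxi, ← norm_mul, hkx]
      _ ≤ ∑ j, A i j * (t * v j) := by
        refine (norm_sum_le _ _).trans (Finset.sum_le_sum fun j _ => ?_)
        rw [norm_mul, Complex.norm_real, Real.norm_of_nonneg (hA i j)]
        exact mul_le_mul_of_nonneg_left (hxj j) (hA i j)
      _ = t * A.mulVec v i := by
        simp only [Matrix.mulVec, dotProduct, Finset.mul_sum]
        exact Finset.sum_congr rfl fun j _ => by ring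
      _ ≤ t * (c * v i) := mul_le_mul_of_nonneg_left (h i) htpos.le
      _ = c * (t * v i) := by ring
  have hkc : ‖k‖ ≤ c := le_of_mul_le_mul_right hle (mul_pos htpos (hv i))
  rw [← enorm_eq_nnnorm, ← ofReal_norm]
  exact ENNReal.ofReal_le_ofReal hkc

namespace WeightedPDA

section Extremal

variable {Q Γ : Type*} [Fintype Γ] [DecidableEq Γ] {Δ : WeightedPDA Q Γ}

theorem condRuntime_le_max {p : Q} {Z : Γ} {q : Q} (h : 0 < Δ.returnProb p Z q) :
    Δ.condRuntime p Z q ≤ Δ.maxCondRuntime :=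
  le_iSup_of_le p (le_iSup_of_le Z (le_iSup_of_le q (le_iSup_of_le h le_rfl)))

theorem minReturnProb_le {p : Q} {Z : Γ} {q : Q} (h : 0 < Δ.returnProb p Z q) :
    Δ.minReturnProb ≤ Δ.returnProb p Z q :=
  iInf_le_of_le p (iInf_le_of_le Z (iInf_le_of_le q (iInf_le_of_le h le_rfl)))

end Extremal

variable {Q Γ : Type*} [Fintype Q] [Fintype Γ]

/-! ### The cleaned-up fundamental system -/

open Classical in
theorem cleanPPS_apply (Δ : WeightedPDA Q Γ) (p : Q) (Z : Γ) (q : Q)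
    (h : Δ.fundamentalPPS.lfp (p, Z, q) ≠ 0) :
    Δ.cleanPPS ⟨(p, Z, q), h⟩
      = MvPolynomial.C (Δ.pop p Z q : ℝ≥0)
        + (∑ r, ∑ Y, MvPolynomial.C (Δ.swap p Z r Y : ℝ≥0)
          * Δ.fundamentalPPS.extendZero MvPolynomial.X (r, Y, q))
        + ∑ r, ∑ Y, ∑ X, MvPolynomial.C (Δ.push p Z r Y X : ℝ≥0)
          * ∑ t, Δ.fundamentalPPS.extendZero MvPolynomial.X (r, Y, t)
            * Δ.fundamentalPPS.extendZero MvPolynomial.X (t, X, q) := by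
  change MvPolynomial.bind₁ _ (Δ.fundamentalPPS (p, Z, q)) = _
  simp only [fundamentalPPS, map_add, map_sum, map_mul, MvPolynomial.bind₁_X_right,
    MvPolynomial.bind₁_C_right]
  rfl

theorem dirDeriv_extendZero_X {J : Type*} [Finite J] (f : PPS J) (u e : f.CleanIndex → ℝ≥0)
    (j : J) : dirDeriv u e (f.extendZero MvPolynomial.X j) = f.extendZero e j := by
  unfold PPS.extendZero
  split_ifs
  · exact dirDeriv_X u e _
  · exact dirDeriv_zero u e

theorem eval_extendZero_X {J : Type*} (f : PPS J) (u : f.CleanIndex → ℝ≥0)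
    (j : J) : MvPolynomial.eval u (f.extendZero MvPolynomial.X j) = f.extendZero u j := by
  unfold PPS.extendZero
  split_ifs
  · exact MvPolynomial.eval_X _
  · exact map_zero _

theorem dirDeriv_cleanPPS (Δ : WeightedPDA Q Γ) (u e : Δ.fundamentalPPS.CleanIndex → ℝ≥0)
    (p : Q) (Z : Γ) (q : Q) (h : Δ.fundamentalPPS.lfp (p, Z, q) ≠ 0) :
    dirDeriv u e (Δ.cleanPPS ⟨(p, Z, q), h⟩)
      = (∑ r, ∑ Y, (Δ.swap p Z r Y : ℝ≥0) * Δ.fundamentalPPS.extendZero e (r, Y, q))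
        + ∑ r, ∑ Y, ∑ X, (Δ.push p Z r Y X : ℝ≥0)
          * ∑ t, (Δ.fundamentalPPS.extendZero e (r, Y, t)
              * Δ.fundamentalPPS.extendZero u (t, X, q)
            + Δ.fundamentalPPS.extendZero u (r, Y, t)
              * Δ.fundamentalPPS.extendZero e (t, X, q)) := by
  rw [cleanPPS_apply]
  simp only [dirDeriv_add, dirDeriv_sum, dirDeriv_mul, dirDeriv_C, MvPolynomial.eval_C,
    dirDeriv_extendZero_X, eval_extendZero_X, zero_mul, zero_add]

theorem extendZero_lfp {Δ : WeightedPDA Q Γ} (hΔ : Δ.IsProbabilistic) (p : Q) (Z : Γ) (q : Q) :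
    ((Δ.fundamentalPPS.extendZero (fun j => (Δ.cleanPPS.lfp j).toNNReal) (p, Z, q) : ℝ≥0) : ℝ≥0∞)
      = Δ.runMoment 0 p [Z] q := by
  by_cases h : Δ.fundamentalPPS.lfp (p, Z, q) = 0
  · rw [PPS.extendZero_of_eq _ _ h, ← fundamentalPPS_lfp, h, ENNReal.coe_zero]
  · rw [PPS.extendZero_of_ne _ _ h]
    refine (congrArg (fun x : ℝ≥0∞ => (x.toNNReal : ℝ≥0∞)) ((PPS.clean_lfp _ _).trans
      (fundamentalPPS_lfp Δ p Z q))).trans (ENNReal.coe_toNNReal ?_)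
    exact ((runMoment_zero_le_one hΔ _ _ _).trans_lt ENNReal.one_lt_top).ne

/-! ### Return probabilities and conditional runtimes -/

section Runtime

variable [DecidableEq Γ] {Δ : WeightedPDA Q Γ}

theorem lfp_eq_returnProb (Δ : WeightedPDA Q Γ) (p : Q) (Z : Γ) (q : Q) :
    Δ.fundamentalPPS.lfp (p, Z, q) = Δ.returnProb p Z q := by
  rw [fundamentalPPS_lfp, returnProb_eq]

theorem returnProb_le_one (hΔ : Δ.IsProbabilistic) (p : Q) (Z : Γ) (q : Q) :
    Δ.returnProb p Z q ≤ 1 := by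
  rw [returnProb_eq]
  exact runMoment_zero_le_one hΔ _ _ _

theorem returnProb_le_firstMoment (Δ : WeightedPDA Q Γ) (p : Q) (Z : Γ) (q : Q) :
    Δ.returnProb p Z q ≤ Δ.firstMoment p Z q := by
  rw [returnProb_eq, firstMoment_eq]
  exact runMoment_zero_le_one_of_cons Δ p Z [] q

theorem one_le_condRuntime (hΔ : Δ.IsProbabilistic) {p : Q} {Z : Γ} {q : Q}
    (h : 0 < Δ.returnProb p Z q) : 1 ≤ Δ.condRuntime p Z q := by
  rw [condRuntime, ENNReal.le_div_iff_mul_le (Or.inl h.ne')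
    (Or.inl ((returnProb_le_one hΔ p Z q).trans_lt ENNReal.one_lt_top).ne), one_mul]
  exact returnProb_le_firstMoment Δ p Z q

theorem one_le_maxCondRuntime (hΔ : Δ.IsProbabilistic) (hpos : ∃ p Z q, 0 < Δ.returnProb p Z q) :
    1 ≤ Δ.maxCondRuntime := by
  obtain ⟨p, Z, q, h⟩ := hpos
  exact (one_le_condRuntime hΔ h).trans (condRuntime_le_max h)

theorem maxCondRuntime_lt_top (hc : Δ.IsCPAST) : Δ.maxCondRuntime < ⊤ := by
  have h : ∀ j : Q × Γ × Q, (⨆ _ : 0 < Δ.returnProb j.1 j.2.1 j.2.2,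
      Δ.condRuntime j.1 j.2.1 j.2.2) < ⊤ := by
    intro j
    by_cases hj : 0 < Δ.returnProb j.1 j.2.1 j.2.2
    · simpa [hj] using hc _ _ _ hj
    · simp [hj]
  -- A finite supremum of finite values is finite; triples with zero return probability contribute
  -- an empty supremum, which is 0.
  refine lt_of_le_of_lt ?_ ((Finset.sup_lt_iff (s := Finset.univ) ENNReal.zero_lt_top).mpr
    fun j _ => h j)
  refine iSup_le fun p => iSup_le fun Z => iSup_le fun q => ?_
  exact Finset.le_sup (f := fun j : Q × Γ × Q => ⨆ _ : 0 < Δ.returnProb j.1 j.2.1 j.2.2,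
    Δ.condRuntime j.1 j.2.1 j.2.2) (Finset.mem_univ (p, Z, q))

theorem firstMoment_le (hΔ : Δ.IsProbabilistic) {p : Q} {Z : Γ} {q : Q}
    (h : 0 < Δ.returnProb p Z q) :
    Δ.firstMoment p Z q ≤ Δ.maxCondRuntime * Δ.returnProb p Z q :=
  (ENNReal.div_le_iff_le_mul (Or.inl h.ne')
    (Or.inl ((returnProb_le_one hΔ p Z q).trans_lt ENNReal.one_lt_top).ne)).mp
    (condRuntime_le_max h)

theorem firstMoment_ne_top (hΔ : Δ.IsProbabilistic) (hc : Δ.IsCPAST) (p : Q) (Z : Γ) (q : Q) :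
    Δ.firstMoment p Z q ≠ ⊤ := by
  by_cases h : 0 < Δ.returnProb p Z q
  · exact ((firstMoment_le hΔ h).trans_lt (ENNReal.mul_lt_top (maxCondRuntime_lt_top hc)
      ((returnProb_le_one hΔ p Z q).trans_lt ENNReal.one_lt_top))).ne
  · rw [firstMoment_eq, runMoment_one_eq_zero]
    · simp
    · rw [← returnProb_eq]
      simpa using h

/-- The first moments of the positive return probabilities. -/
def cleanMoment (Δ : WeightedPDA Q Γ) (j : Δ.fundamentalPPS.CleanIndex) : ℝ≥0 :=
  (Δ.firstMoment j.1.1 j.1.2.1 j.1.2.2).toNNReal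

theorem extendZero_cleanMoment (hΔ : Δ.IsProbabilistic) (hc : Δ.IsCPAST) (p : Q) (Z : Γ) (q : Q) :
    ((Δ.fundamentalPPS.extendZero Δ.cleanMoment (p, Z, q) : ℝ≥0) : ℝ≥0∞) = Δ.runMoment 1 p [Z] q := by
  by_cases h : Δ.fundamentalPPS.lfp (p, Z, q) = 0
  · rw [PPS.extendZero_of_eq _ _ h, runMoment_one_eq_zero, ENNReal.coe_zero]
    rwa [← fundamentalPPS_lfp]
  · rw [PPS.extendZero_of_ne _ _ h, ← firstMoment_eq]
    exact ENNReal.coe_toNNReal (firstMoment_ne_top hΔ hc _ _ _)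

/-- The first moments solve the linear system `E = μ + f'(μ) E`. -/
theorem cleanMoment_eq (hΔ : Δ.IsProbabilistic) (hc : Δ.IsCPAST)
    (j : Δ.fundamentalPPS.CleanIndex) :
    (Δ.cleanMoment j : ℝ≥0∞) = Δ.returnProb j.1.1 j.1.2.1 j.1.2.2
      + dirDeriv (fun j => (Δ.cleanPPS.lfp j).toNNReal) Δ.cleanMoment (Δ.cleanPPS j) := by
  obtain ⟨⟨p, Z, q⟩, h⟩ := j
  rw [dirDeriv_cleanPPS]
  simp only [ENNReal.coe_add, ENNReal.ofNNReal_finsetSum, ENNReal.coe_mul,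
    extendZero_cleanMoment hΔ hc, extendZero_lfp hΔ]
  -- The derivative at μ in the direction E has become, term by term, the right-hand side of
  -- `firstMoment_recursion`.
  rw [returnProb_eq, ← firstMoment_recursion, ← firstMoment_eq]
  exact ENNReal.coe_toNNReal (firstMoment_ne_top hΔ hc _ _ _)

theorem returnProb_pos (j : Δ.fundamentalPPS.CleanIndex) :
    0 < Δ.returnProb j.1.1 j.1.2.1 j.1.2.2 := by
  rw [← lfp_eq_returnProb]
  exact pos_iff_ne_zero.mpr j.2

theorem returnProb_toReal_le_cleanMoment (hΔ : Δ.IsProbabilistic) (hc : Δ.IsCPAST)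
    (j : Δ.fundamentalPPS.CleanIndex) :
    (Δ.returnProb j.1.1 j.1.2.1 j.1.2.2).toReal ≤ Δ.cleanMoment j :=
  ENNReal.toReal_mono (firstMoment_ne_top hΔ hc _ _ _) (returnProb_le_firstMoment Δ _ _ _)

theorem cleanMoment_le (hΔ : Δ.IsProbabilistic) (hc : Δ.IsCPAST)
    (j : Δ.fundamentalPPS.CleanIndex) : (Δ.cleanMoment j : ℝ)
      ≤ Δ.maxCondRuntime.toReal * (Δ.returnProb j.1.1 j.1.2.1 j.1.2.2).toReal := by
  rw [← ENNReal.toReal_mul]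
  exact ENNReal.toReal_mono (ENNReal.mul_lt_top (maxCondRuntime_lt_top hc)
    ((returnProb_le_one hΔ _ _ _).trans_lt ENNReal.one_lt_top)).ne
    (firstMoment_le hΔ (returnProb_pos j))

theorem cleanMoment_pos (hΔ : Δ.IsProbabilistic) (hc : Δ.IsCPAST)
    (j : Δ.fundamentalPPS.CleanIndex) : 0 < (Δ.cleanMoment j : ℝ) :=
  (ENNReal.toReal_pos (returnProb_pos j).ne'
    ((returnProb_le_one hΔ _ _ _).trans_lt ENNReal.one_lt_top).ne).trans_le
    (returnProb_toReal_le_cleanMoment hΔ hc j)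

theorem mulVec_cleanMoment (hΔ : Δ.IsProbabilistic) (hc : Δ.IsCPAST)
    (j : Δ.fundamentalPPS.CleanIndex) :
    Δ.cleanPPS.jacobiLfp.mulVec (fun j => (Δ.cleanMoment j : ℝ)) j
      = Δ.cleanMoment j - (Δ.returnProb j.1.1 j.1.2.1 j.1.2.2).toReal := by
  have h := congrArg ENNReal.toReal (cleanMoment_eq hΔ hc j)
  rw [ENNReal.toReal_add ((returnProb_le_one hΔ _ _ _).trans_lt ENNReal.one_lt_top).ne
    ENNReal.coe_ne_top, ENNReal.coe_toReal, ENNReal.coe_toReal] at h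
  rw [PPS.jacobiLfp, jacobi_mulVec, h]
  ring

theorem mulVec_cleanMoment_le (hΔ : Δ.IsProbabilistic) (hc : Δ.IsCPAST)
    (hpos : ∃ p Z q, 0 < Δ.returnProb p Z q) (j : Δ.fundamentalPPS.CleanIndex) :
    Δ.cleanPPS.jacobiLfp.mulVec (fun j => (Δ.cleanMoment j : ℝ)) j
      ≤ (1 - Δ.maxCondRuntime.toReal⁻¹) * Δ.cleanMoment j := by
  have hC : 0 < Δ.maxCondRuntime.toReal :=
    ENNReal.toReal_pos (zero_lt_one.trans_le (one_le_maxCondRuntime hΔ hpos)).ne'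
      (maxCondRuntime_lt_top hc).ne
  -- After cancelling E, what remains is E/C ≤ μ, the definition of C as a maximum.
  rw [mulVec_cleanMoment hΔ hc, sub_mul, one_mul, sub_le_sub_iff_left, inv_mul_le_iff₀ hC]
  exact cleanMoment_le hΔ hc j

theorem sum_cleanMoment_le (hΔ : Δ.IsProbabilistic) (hc : Δ.IsCPAST) :
    ∑ j, (Δ.cleanMoment j : ℝ)
      ≤ Δ.maxCondRuntime.toReal * (Fintype.card Q : ℝ) ^ 2 * (Fintype.card Γ : ℝ) := by
  have hle : ∀ j ∈ Finset.univ, (Δ.cleanMoment j : ℝ) ≤ Δ.maxCondRuntime.toReal := by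
    intro j _
    refine (cleanMoment_le hΔ hc j).trans (mul_le_of_le_one_right ENNReal.toReal_nonneg ?_)
    exact ENNReal.toReal_le_of_le_ofReal zero_le_one
      ((returnProb_le_one hΔ _ _ _).trans ENNReal.ofReal_one.ge)
  have hcard : Fintype.card Δ.fundamentalPPS.CleanIndex ≤ Fintype.card (Q × Γ × Q) :=
    Fintype.card_le_of_injective (fun j => j.1) Subtype.val_injective
  refine (Finset.sum_le_card_nsmul _ _ _ hle).trans ?_
  rw [nsmul_eq_mul, Finset.card_univ]
  calc (Fintype.card Δ.fundamentalPPS.CleanIndex : ℝ) * Δ.maxCondRuntime.toReal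
      ≤ (Fintype.card (Q × Γ × Q) : ℝ) * Δ.maxCondRuntime.toReal := by
        gcongr
    _ = _ := by
        rw [Fintype.card_prod, Fintype.card_prod]
        push_cast
        ring

theorem jacobiLfp_nonneg {J : Type*} (f : PPS J) (i j : J) : 0 ≤ f.jacobiLfp i j :=
  NNReal.coe_nonneg _

theorem exists_vector (hΔ : Δ.IsProbabilistic) (hc : Δ.IsCPAST)
    (hpos : ∃ p Z q, 0 < Δ.returnProb p Z q) :
    ∃ v : Δ.fundamentalPPS.CleanIndex → ℝ,
      (∀ j, 0 < v j) ∧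
      (∑ j, |v j| = 1) ∧
      (∀ i, (Δ.cleanPPS.jacobiLfp.mulVec v) i ≤ (1 - Δ.maxCondRuntime.toReal⁻¹) * v i) ∧
      (∀ j, Δ.minReturnProb.toReal /
          (Δ.maxCondRuntime.toReal * (Fintype.card Q : ℝ) ^ 2 * (Fintype.card Γ : ℝ)) ≤ v j) := by
  have hS : 0 < ∑ j, (Δ.cleanMoment j : ℝ) := by
    obtain ⟨p, Z, q, h⟩ := hpos
    rw [← lfp_eq_returnProb] at h
    exact Finset.sum_pos (fun j _ => cleanMoment_pos hΔ hc j) ⟨⟨(p, Z, q), h.ne'⟩, Finset.mem_univ _⟩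
  set S := ∑ j, (Δ.cleanMoment j : ℝ)
  -- The witness is the vector of first moments, normalised.
  refine ⟨S⁻¹ • fun j => (Δ.cleanMoment j : ℝ), fun j => ?_, ?_, fun i => ?_, fun j => ?_⟩
  · exact mul_pos (inv_pos.mpr hS) (cleanMoment_pos hΔ hc j)
  · have h : ∀ j, |(S⁻¹ • fun j => (Δ.cleanMoment j : ℝ)) j| = S⁻¹ * Δ.cleanMoment j := fun j =>
      abs_of_pos (mul_pos (inv_pos.mpr hS) (cleanMoment_pos hΔ hc j))
    simp only [h, ← Finset.mul_sum]
    exact inv_mul_cancel₀ hS.ne'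
  · rw [Matrix.mulVec_smul, Pi.smul_apply, Pi.smul_apply, smul_eq_mul, smul_eq_mul, mul_left_comm]
    exact mul_le_mul_of_nonneg_left (mulVec_cleanMoment_le hΔ hc hpos i) (inv_pos.mpr hS).le
  · rw [Pi.smul_apply, smul_eq_mul, inv_mul_eq_div]
    refine div_le_div₀ (NNReal.coe_nonneg _) ?_ hS (sum_cleanMoment_le hΔ hc)
    refine le_trans (ENNReal.toReal_mono ?_ (minReturnProb_le (returnProb_pos j)))
      (returnProb_toReal_le_cleanMoment hΔ hc j)
    exact ((returnProb_le_one hΔ _ _ _).trans_lt ENNReal.one_lt_top).ne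

theorem specRad_cleanPPS_le (hΔ : Δ.IsProbabilistic) (hc : Δ.IsCPAST)
    (hpos : ∃ p Z q, 0 < Δ.returnProb p Z q) :
    specRad Δ.cleanPPS.jacobiLfp ≤ ENNReal.ofReal (1 - Δ.maxCondRuntime.toReal⁻¹) :=
  specRad_le_of_mulVec_le (jacobiLfp_nonneg _) (cleanMoment_pos hΔ hc)
    (mulVec_cleanMoment_le hΔ hc hpos)

end Runtime

end WeightedPDA

/-! ### The branching automaton -/

section Branching

theorem branchingPDA_isProbabilistic {a : ℚ≥0} (ha : a ≤ 1) :
    (branchingPDA a).IsProbabilistic := by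
  intro p Z
  simp [branchingPDA, add_tsub_cancel_of_le ha]

theorem coe_one_tsub {a : ℚ≥0} (ha : a ≤ 1) :
    (((1 - a : ℚ≥0) : ℝ≥0) : ℝ≥0∞) = ENNReal.ofReal (1 - (a : ℝ)) := by
  have h : (((1 - a : ℚ≥0) : ℝ≥0) : ℝ) = 1 - (a : ℝ) := by
    change (((1 - a : ℚ≥0)) : ℝ) = 1 - (a : ℝ)
    rw [eq_sub_iff_add_eq]
    exact_mod_cast tsub_add_cancel_of_le ha
  rw [← h, ENNReal.ofReal_coe_nnreal]

theorem coe_weight (a : ℚ≥0) : ((a : ℝ≥0) : ℝ≥0∞) = ENNReal.ofReal (a : ℝ) := by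
  rw [← ENNReal.ofReal_coe_nnreal]
  rfl

theorem sum_branchingPDA_moveWeight (a : ℚ≥0) (F : WeightedPDA.Move Unit Unit → ℝ≥0∞) :
    ∑ m, ((branchingPDA a).moveWeight () () m : ℝ≥0∞) * F m
      = ((a : ℝ≥0) : ℝ≥0∞) * F ((), none)
        + (((1 - a : ℚ≥0) : ℝ≥0) : ℝ≥0∞) * F ((), some ((), some ())) := by
  rw [WeightedPDA.sum_move]
  simp [WeightedPDA.moveWeight, branchingPDA]

variable {a : ℚ≥0}

theorem half_lt_cast (ha : 1 / 2 < a) : 1 / 2 < (a : ℝ) := by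
  have : ((1 / 2 : ℚ≥0) : ℝ) < (a : ℝ) := by exact_mod_cast ha
  simpa using this

theorem cast_le_one (ha : a ≤ 1) : (a : ℝ) ≤ 1 := by exact_mod_cast ha

theorem branchingPDA_runMoment_zero (ha : 1 / 2 < a) (ha' : a ≤ 1) :
    (branchingPDA a).runMoment 0 () [()] () = 1 := by
  have hle := WeightedPDA.runMoment_zero_le_one (branchingPDA_isProbabilistic ha') () [()] ()
  have hne := (hle.trans_lt ENNReal.one_lt_top).ne
  have h := WeightedPDA.runMoment_zero_cons (branchingPDA a) () () [] ()
  rw [sum_branchingPDA_moveWeight] at h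
  simp only [WeightedPDA.Move.word, List.append_nil, WeightedPDA.runMoment_zero_nil, if_true,
    mul_one] at h
  have happ := WeightedPDA.runMoment_zero_append (branchingPDA a) () [()] [()] ()
  simp only [Finset.univ_unique, Finset.sum_singleton, List.singleton_append,
    PUnit.default_eq_unit] at happ
  rw [happ, coe_one_tsub ha', coe_weight] at h
  have h1 := half_lt_cast ha
  have h2 := cast_le_one ha'
  have h' := congrArg ENNReal.toReal h
  rw [ENNReal.toReal_add ENNReal.ofReal_ne_top
    (ENNReal.mul_ne_top ENNReal.ofReal_ne_top (ENNReal.mul_ne_top hne hne)),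
    ENNReal.toReal_mul, ENNReal.toReal_mul, ENNReal.toReal_ofReal (by linarith),
    ENNReal.toReal_ofReal (by linarith)] at h'
  rw [← ENNReal.toReal_eq_one_iff]
  have hr : ((branchingPDA a).runMoment 0 () [()] ()).toReal ≤ 1 :=
    ENNReal.toReal_le_of_le_ofReal zero_le_one (hle.trans ENNReal.ofReal_one.ge)
  set r := ((branchingPDA a).runMoment 0 () [()] ()).toReal
  -- The equation r = a + (1 - a)r² factors; since r ≤ 1, the second factor is at least 2a - 1 > 0,
  -- so r = 1.
  have hprod : (1 - r) * ((a : ℝ) - (1 - a) * r) = 0 := by linear_combination -h'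
  have hpos : 0 < (a : ℝ) - (1 - a) * r := by
    have := mul_le_mul_of_nonneg_left hr (sub_nonneg.mpr h2)
    linarith
  linarith [(mul_eq_zero.mp hprod).resolve_right hpos.ne']

/-- The equation E = 1 + 2(1 - a)E also admits E = ∞, so finiteness needs its own proof. Charging w
= 1/(2a - 1) per stack symbol works: with stack length L, 1 + a(L - 1)w + (1 - a)(L + 1)w = Lw. -/
theorem branchingPDA_runMoment_one_le (ha : 1 / 2 < a) (ha' : a ≤ 1) :
    (branchingPDA a).runMoment 1 () [()] () ≤ ENNReal.ofReal (1 / (2 * (a : ℝ) - 1)) := by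
  have h1 := half_lt_cast ha
  have h2 := cast_le_one ha'
  set w : ℝ := 1 / (2 * (a : ℝ) - 1) with hw
  have hwpos : 0 < w := by
    rw [hw]
    exact one_div_pos.mpr (by linarith)
  have hweq : w * (2 * (a : ℝ) - 1) = 1 := div_mul_cancel₀ 1 (by linarith)
  have hΔ := branchingPDA_isProbabilistic ha'
  have key : ∀ (N : ℕ) (α : List Unit),
      ∑ n ∈ Finset.range N, (branchingPDA a).hitWeight n () α () * (n : ℝ≥0∞)
        ≤ ENNReal.ofReal (α.length * w) := by
    intro N
    induction N with
    | zero => simp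
    | succ N ih =>
      intro α
      rw [Finset.sum_range_succ']
      rcases α with _ | ⟨⟨⟩, β⟩
      · simp [WeightedPDA.hitWeight]
      · have hstep : ∑ n ∈ Finset.range N,
            (branchingPDA a).hitWeight (n + 1) () (() :: β) () * ((n + 1 : ℕ) : ℝ≥0∞)
            = (∑ n ∈ Finset.range N, (branchingPDA a).hitWeight (n + 1) () (() :: β) ())
              + (ENNReal.ofReal a
                  * (∑ n ∈ Finset.range N, (branchingPDA a).hitWeight n () β () * (n : ℝ≥0∞))
                + ENNReal.ofReal (1 - a) * (∑ n ∈ Finset.range N,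
                  (branchingPDA a).hitWeight n () (() :: () :: β) () * (n : ℝ≥0∞))) := by
          rw [Finset.mul_sum, Finset.mul_sum, ← Finset.sum_add_distrib, ← Finset.sum_add_distrib]
          refine Finset.sum_congr rfl fun n _ => ?_
          rw [WeightedPDA.hitWeight_succ_cons, sum_branchingPDA_moveWeight, coe_one_tsub ha',
            coe_weight]
          simp only [WeightedPDA.Move.word, List.nil_append, List.cons_append]
          push_cast
          ring
        have hone : ∑ n ∈ Finset.range N, (branchingPDA a).hitWeight (n + 1) () (() :: β) () ≤ 1 := by
          have h := WeightedPDA.sum_hitWeight_le_one hΔ (N + 1) () (() :: β)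
          rw [Finset.sum_range_succ'] at h
          simp only [Finset.univ_unique, Finset.sum_singleton, PUnit.default_eq_unit,
            WeightedPDA.hitWeight_zero_cons, add_zero] at h
          exact h
        rw [hstep, Nat.cast_zero, mul_zero, add_zero]
        refine (add_le_add hone (add_le_add (mul_le_mul_right (ih β) _)
          (mul_le_mul_right (ih (() :: () :: β)) _))).trans ?_
        rw [← ENNReal.ofReal_one, ← ENNReal.ofReal_mul (by linarith),
          ← ENNReal.ofReal_mul (by linarith),
          ← ENNReal.ofReal_add (by positivity) (mul_nonneg (by linarith) (by positivity)),
          ← ENNReal.ofReal_add zero_le_one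
            (add_nonneg (by positivity) (mul_nonneg (by linarith) (by positivity)))]
        refine ENNReal.ofReal_le_ofReal (le_of_eq ?_)
        simp only [List.length_cons]
        push_cast
        linear_combination -hweq
  rw [WeightedPDA.runMoment_one, ENNReal.tsum_eq_iSup_nat]
  refine iSup_le fun N => (key N [()]).trans ?_
  simp

theorem branchingPDA_runMoment_one (ha : 1 / 2 < a) (ha' : a ≤ 1) :
    (branchingPDA a).runMoment 1 () [()] () = ENNReal.ofReal (1 / (2 * (a : ℝ) - 1)) := by
  have h1 := half_lt_cast ha
  have h2 := cast_le_one ha'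
  have hne := ((branchingPDA_runMoment_one_le ha ha').trans_lt ENNReal.ofReal_lt_top).ne
  have h := WeightedPDA.runMoment_one_cons (branchingPDA a) () () [] ()
  rw [sum_branchingPDA_moveWeight, branchingPDA_runMoment_zero ha ha'] at h
  simp only [WeightedPDA.Move.word, List.append_nil, WeightedPDA.runMoment_one_nil,
    mul_zero, zero_add] at h
  have happ := WeightedPDA.runMoment_one_append (branchingPDA a) () [()] [()] ()
  simp only [Finset.univ_unique, Finset.sum_singleton, List.singleton_append,
    PUnit.default_eq_unit, branchingPDA_runMoment_zero ha ha', mul_one, one_mul] at happ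
  rw [happ, coe_one_tsub ha'] at h
  rw [← ENNReal.ofReal_toReal hne]
  congr 1
  have h' := congrArg ENNReal.toReal h
  rw [ENNReal.toReal_add ENNReal.one_ne_top
    (ENNReal.mul_ne_top ENNReal.ofReal_ne_top (ENNReal.add_ne_top.mpr ⟨hne, hne⟩)),
    ENNReal.toReal_mul, ENNReal.toReal_add hne hne, ENNReal.toReal_ofReal (by linarith),
    ENNReal.toReal_one] at h'
  rw [eq_div_iff (by linarith)]
  linear_combination h'

theorem branchingPDA_returnProb (ha : 1 / 2 < a) (ha' : a ≤ 1) (p Z q : Unit) :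
    (branchingPDA a).returnProb p Z q = 1 := by
  rw [WeightedPDA.returnProb_eq]
  exact branchingPDA_runMoment_zero ha ha'

theorem branchingPDA_condRuntime (ha : 1 / 2 < a) (ha' : a ≤ 1) (p Z q : Unit) :
    (branchingPDA a).condRuntime p Z q = ENNReal.ofReal (1 / (2 * (a : ℝ) - 1)) := by
  rw [WeightedPDA.condRuntime, branchingPDA_returnProb ha ha', div_one, WeightedPDA.firstMoment_eq]
  exact branchingPDA_runMoment_one ha ha'

theorem branchingPDA_isCPAST (ha : 1 / 2 < a) (ha' : a ≤ 1) : (branchingPDA a).IsCPAST := by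
  intro p Z q _
  rw [branchingPDA_condRuntime ha ha']
  exact ENNReal.ofReal_lt_top

theorem branchingPDA_maxCondRuntime (ha : 1 / 2 < a) (ha' : a ≤ 1) :
    (branchingPDA a).maxCondRuntime = ENNReal.ofReal (1 / (2 * (a : ℝ) - 1)) := by
  simp only [WeightedPDA.maxCondRuntime, branchingPDA_returnProb ha ha',
    branchingPDA_condRuntime ha ha', zero_lt_one, iSup_pos, ciSup_const]

/-- A non-empty matrix that acts as a scalar has that scalar as spectral radius. -/
theorem specRad_algebraMap {I : Type*} [Fintype I] [DecidableEq I] [Nonempty I] {c : ℝ}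
    (hc : 0 ≤ c) : specRad (algebraMap ℝ (Matrix I I ℝ) c) = ENNReal.ofReal c := by
  have h : (algebraMap ℝ (Matrix I I ℝ) c).map (algebraMap ℝ ℂ)
      = algebraMap ℂ (Matrix I I ℂ) (c : ℂ) := by
    ext i j
    simp [Matrix.algebraMap_matrix_apply, apply_ite (Complex.ofReal)]
  rw [specRad, spectralRadius, h, spectrum.scalar_eq]
  simp only [Set.mem_singleton_iff, iSup_iSup_eq_left]
  rw [← enorm_eq_nnnorm, ← ofReal_norm, Complex.norm_real, Real.norm_of_nonneg hc]

theorem branchingPDA_specRad (ha : 1 / 2 < a) (ha' : a ≤ 1) :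
    specRad (branchingPDA a).cleanPPS.jacobiLfp = ENNReal.ofReal (2 * (1 - (a : ℝ))) := by
  have h1 := half_lt_cast ha
  have h2 := cast_le_one ha'
  have hΔ := branchingPDA_isProbabilistic ha'
  have hc := branchingPDA_isCPAST ha ha'
  have hlfp : (branchingPDA a).fundamentalPPS.lfp ((), (), ()) ≠ 0 := by
    rw [WeightedPDA.lfp_eq_returnProb, branchingPDA_returnProb ha ha']
    exact one_ne_zero
  let j₀ : (branchingPDA a).fundamentalPPS.CleanIndex := ⟨((), (), ()), hlfp⟩
  have : Subsingleton (branchingPDA a).fundamentalPPS.CleanIndex :=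
    ⟨fun i j => Subtype.ext (Subsingleton.elim i.1 j.1)⟩
  have : Nonempty (branchingPDA a).fundamentalPPS.CleanIndex := ⟨j₀⟩
  have hentry : (branchingPDA a).cleanPPS.jacobiLfp j₀ j₀ = 2 * (1 - (a : ℝ)) := by
    -- With one variable, f̂'(μ)E = E - 1 and E = 1/(2a - 1) determine the entry without
    -- differentiating.
    have h := WeightedPDA.mulVec_cleanMoment hΔ hc j₀
    have hE : ((branchingPDA a).cleanMoment j₀ : ℝ) = 1 / (2 * (a : ℝ) - 1) := by
      have : (branchingPDA a).firstMoment () () () = ENNReal.ofReal (1 / (2 * (a : ℝ) - 1)) := by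
        rw [WeightedPDA.firstMoment_eq]
        exact branchingPDA_runMoment_one ha ha'
      change ((branchingPDA a).firstMoment () () ()).toReal = _
      rw [this, ENNReal.toReal_ofReal (one_div_nonneg.mpr (by linarith))]
    rw [branchingPDA_returnProb ha ha', Matrix.mulVec, dotProduct, Fintype.sum_subsingleton _ j₀,
      hE, ENNReal.toReal_one] at h
    have h3 : 2 * (a : ℝ) - 1 ≠ 0 := by linarith
    field_simp at h
    linarith
  have hmat : (branchingPDA a).cleanPPS.jacobiLfp = algebraMap ℝ _ (2 * (1 - (a : ℝ))) := by
    ext i j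
    rw [Subsingleton.elim i j₀, Subsingleton.elim j j₀, hentry, Matrix.algebraMap_matrix_apply,
      if_pos rfl]
    rfl
  rw [hmat, specRad_algebraMap (by linarith)]

end Branching

end

theorem lemma10 :
    -- the bound, for every conditionally PAST probabilistic pushdown automaton with at least one
    -- positive return probability
    (∀ (Q Γ : Type*) [Fintype Q] [Fintype Γ] [DecidableEq Γ]
        (Δ : WeightedPDA Q Γ), Δ.IsProbabilistic → Δ.IsCPAST →
        (∃ p Z q, 0 < Δ.returnProb p Z q) →
      (1 ≤ Δ.maxCondRuntime ∧ Δ.maxCondRuntime < ⊤) ∧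
      (∀ j, Δ.cleanPPS.lfp j < ⊤) ∧
      (∃ v : Δ.fundamentalPPS.CleanIndex → ℝ,
        (∀ j, 0 < v j) ∧
        (∑ j, |v j| = 1) ∧
        (∀ i, (Δ.cleanPPS.jacobiLfp.mulVec v) i ≤ (1 - Δ.maxCondRuntime.toReal⁻¹) * v i) ∧
        (∀ j, Δ.minReturnProb.toReal /
            (Δ.maxCondRuntime.toReal * (Fintype.card Q : ℝ) ^ 2 * (Fintype.card Γ : ℝ)) ≤ v j)) ∧
      specRad Δ.cleanPPS.jacobiLfp ≤ ENNReal.ofReal (1 - Δ.maxCondRuntime.toReal⁻¹)) ∧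
    -- tightness of the bound on the spectral radius
    (∀ a : ℚ≥0, 1 / 2 < a → a ≤ 1 →
      (branchingPDA a).IsProbabilistic ∧ (branchingPDA a).IsCPAST ∧
      (branchingPDA a).maxCondRuntime = ENNReal.ofReal (1 / (2 * (a : ℝ) - 1)) ∧
      specRad (branchingPDA a).cleanPPS.jacobiLfp = ENNReal.ofReal (2 * (1 - (a : ℝ))) ∧
      specRad (branchingPDA a).cleanPPS.jacobiLfp =
        ENNReal.ofReal (1 - (branchingPDA a).maxCondRuntime.toReal⁻¹)) := by

  refine ⟨fun Q Γ _ _ _ Δ hΔ hc hpos => ⟨⟨WeightedPDA.one_le_maxCondRuntime hΔ hpos,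
    WeightedPDA.maxCondRuntime_lt_top hc⟩, fun j => ?_, WeightedPDA.exists_vector hΔ hc hpos,
    WeightedPDA.specRad_cleanPPS_le hΔ hc hpos⟩, fun a ha ha' =>
    ⟨branchingPDA_isProbabilistic ha', branchingPDA_isCPAST ha ha',
      branchingPDA_maxCondRuntime ha ha', branchingPDA_specRad ha ha', ?_⟩⟩
  · rw [PPS.clean_lfp]
    exact ((WeightedPDA.lfp_eq_returnProb Δ _ _ _).trans_le
      (WeightedPDA.returnProb_le_one hΔ _ _ _)).trans_lt ENNReal.one_lt_top
  · have h := half_lt_cast ha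
    rw [branchingPDA_specRad ha ha', branchingPDA_maxCondRuntime ha ha',
      ENNReal.toReal_ofReal (one_div_nonneg.mpr (by linarith)), one_div, inv_inv]
    congr 1
    ring
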